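/- All relational structures are multisorted: a signature consists of finitely many types and finitely many relation symbols, each symbol $R$ having as arity a finite (possibly empty) tuple $(t_1,\dots,t_n)$ of types; a structure $\mathbf A$ has a set $A_t$ for each type $t$ and a relation $R^{\mathbf A}\subseteq A_{t_1}\times\dots\times A_{t_n}$ for each $R$; homomorphisms are type-preserving maps that preserve all relations, and $\mathbf X\to\mathbf A$ means that one exists. A promise template is a pair $\mathbf A,\mathbf A'$ of structures of the same signature with $\mathbf A$ finite, $\mathbf A'$ possibly infinite, and $\mathbf A\to\mathbf A'$. An instance of $\mathrm{PCSP}(\mathbf A,\mathbf A')$ is a finite structure $\mathbf X$ of that signature, to be accepted if $\mathbf X\to\mathbf A$ and rejected if $\mathbf X\not\to\mathbf A'$. For a finite set $N$, let $\mathrm{Pol}(\mathbf A,\mathbf A')^{(N)}$ be the set of homomorphisms $f\colon\mathbf A^N\to\mathbf A'$, and for $\pi\colon N\to N'$ let $f^\pi\in\mathrm{Pol}(\mathbf A,\mathbf A')^{(N')}$ be given by $f^\pi(x)=f(x\circ\pi)$. A minion homomorphism $\mathrm{Pol}(\mathbf B,\mathbf B')\to\mathrm{Pol}(\mathbf A,\mathbf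 A')$ is a collection of maps $\xi_N\colon\mathrm{Pol}(\mathbf B,\mathbf B')^{(N)}\to\mathrm{Pol}(\mathbf A,\mathbf A')^{(N)}$, one for each finite set $N$, with $\xi_{N'}(f^\pi)=\xi_N(f)^\pi$ for all $\pi\colon N\to N'$; the two templates may have different signatures. Let $k\ge 1$. For a set $K$ of elements of $\mathbf X$ let $\mathcal F_K$ be the set of partial homomorphisms from $K$ to $\mathbf A$, i.e. type-preserving maps $K\to\mathbf A$ that preserve every tuple of every relation of $\mathbf X$ all of whose entries lie in $K$. The $k$-th level of the Sherali–Adams relaxation, $\mathrm{SA}^k(\mathbf X)$, is the linear program over $\mathbb Q$ with variables $x_{K,f}\in[0,1]$, for each set $K$ of at most $k$ elements of $\mathbf X$ and each $f\in\mathcal F_K$, and equations $$\sum_{f\in\mathcal F_K}x_{K,f}=1\ \ (|K|\le k),\qquad \sum_{f\in\mathcal F_K,\ f|_L=g}x_{K,f}=x_{L,g}\ \ (L\subseteq K,\ |K|\le k,\ g\in\mathcal F_L).$$ The $k$-th level solves $\mathrm{PCSP}(\mathbf A,\mathbf A')$ if, for every instance $\mathbf X$, the program $\mathrm{SA}^k(\mathbf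 X)$ is feasible whenever $\mathbf X\to\mathbf A$ (this always holds) and infeasible whenever $\mathbf X\not\to\mathbf A'$. **Corollary 4.3.** Let $\mathbf A,\mathbf A'$ and $\mathbf B,\mathbf B'$ be two promise templates such that there is a minion homomorphism $\mathrm{Pol}(\mathbf B,\mathbf B')\to\mathrm{Pol}(\mathbf A,\mathbf A')$. If $\mathrm{PCSP}(\mathbf B,\mathbf B')$ is solved by the $k$-th level of the Sherali–Adams relaxation for some $k\ge1$, then $\mathrm{PCSP}(\mathbf A,\mathbf A')$ is solved by the $\ell$-th level for some $\ell\ge1$. -/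

import Mathlib

open scoped Classical

universe u v

namespace PCSP

/-- A multisorted relational signature: the arity of a symbol `R` is the tuple
`ar R 0, …, ar R (len R - 1)` of types (nullary symbols are allowed). -/
structure Signature where
  Typ : Type
  Sym : Type
  len : Sym → ℕ
  ar : (R : Sym) → Fin (len R) → Typ

/-- A signature is finite if it has finitely many types and finitely many symbols. -/
class Signature.IsFinite (S : Signature) : Prop where
  typ : Finite S.Typ
  sym : Finite S.Sym

/-- A multisorted relational structure of signature `S`. -/
structure Struct (S : Signature) where
  dom : S.Typ → Type*
  rel : (R : S.Sym) → Set ((i : Fin (S.len R)) → dom (S.ar R i))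

/-- Over a finite signature, a structure is finite if each of its domains is finite. -/
class Struct.IsFinite {S : Signature} (A : Struct S) : Prop where
  dom : ∀ t, Finite (A.dom t)

attribute [instance] Struct.IsFinite.dom

/-- The elements of a structure; elements of different types are always different. -/
abbrev Struct.Elem {S : Signature} (A : Struct S) : Type _ := Σ t : S.Typ, A.dom t

/-- Homomorphisms of structures. -/
structure Hom {S : Signature} (A : Struct S) (B : Struct S) where
  toFun : (t : S.Typ) → A.dom t → B.dom t
  map_rel : ∀ (R : S.Sym), ∀ a ∈ A.rel R, (fun i => toFun (S.ar R i) (a i)) ∈ B.rel R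

/-- `A → B`: there is a homomorphism from `A` to `B`. -/
def MapsTo {S : Signature} (A : Struct S) (B : Struct S) : Prop := Nonempty (Hom A B)

/-- The `N`-fold power `A^N` of a structure. -/
def Struct.power {S : Signature} (A : Struct S) (N : Type) : Struct S where
  dom t := N → A.dom t
  rel R := {b | ∀ n : N, (fun i => b i n) ∈ A.rel R}

/-- `Pol A A' N` is the set of polymorphisms of `(A, A')` of arity `N`, i.e. of homomorphisms
`A^N → A'`. -/
abbrev Pol {S : Signature} (A : Struct S) (A' : Struct S) (N : Type) : Type _ :=
  Hom (A.power N) A'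

/-- The minor `f^π` of a polymorphism `f` along `π : N → N'`: `f^π(x) = f(x ∘ π)`. -/
def Pol.minor {S : Signature} {A : Struct S} {A' : Struct S} {N N' : Type}
    (π : N → N') (f : Pol A A' N) : Pol A A' N' where
  toFun t x := f.toFun t (x ∘ π)
  map_rel R b hb := f.map_rel R (fun i => b i ∘ π) fun n => hb (π n)

/-- A minion homomorphism `Pol(B, B') → Pol(A, A')`: a map `Pol(B, B')^(N) → Pol(A, A')^(N)` for
every finite set `N`, commuting with taking minors. -/
structure PolMinionHom {S T : Signature} (B : Struct T) (B' : Struct T)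
    (A : Struct S) (A' : Struct S) where
  map : (N : Type) → [Finite N] → Pol B B' N → Pol A A' N
  map_minor : ∀ (N N' : Type) [Finite N] [Finite N'] (π : N → N') (f : Pol B B' N),
    map N' (Pol.minor π f) = Pol.minor π (map N f)

/-- Partial homomorphisms from a finite set `K` of elements of `X` to `A`: type-preserving maps
`K → A` that preserve all constraints of `X` whose scope lies in `K`. -/
@[ext]
structure PartialHom {S : Signature} (X : Struct S) (A : Struct S) (K : Finset X.Elem) where
  toFun : (v : K) → A.dom v.1.1
  map_rel : ∀ (R : S.Sym), ∀ a ∈ X.rel R, ∀ h : ∀ i, (⟨S.ar R i, a i⟩ : X.Elem) ∈ K,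
    (fun i => toFun ⟨⟨S.ar R i, a i⟩, h i⟩) ∈ A.rel R

/-- The restriction `f|_L` of a partial homomorphism. -/
def PartialHom.restrict {S : Signature} {X : Struct S} {A : Struct S} {K L : Finset X.Elem}
    (hLK : L ⊆ K) (f : PartialHom X A K) : PartialHom X A L where
  toFun v := f.toFun ⟨v.1, hLK v.2⟩
  map_rel R a ha h := f.map_rel R a ha fun i => hLK (h i)

noncomputable instance PartialHom.instFintype {S : Signature} (X : Struct S) (A : Struct S)
    [A.IsFinite] (K : Finset X.Elem) : Fintype (PartialHom X A K) :=
  have : Finite (PartialHom X A K) :=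
    Finite.of_injective (fun f => f.toFun) fun _ _ h => PartialHom.ext h
  Fintype.ofFinite _

/-- `x` is a feasible solution of the linear program `SA^k(X)` with template `A`. The variables
are the `x K f` with `|K| ≤ k`; the values of `x` at larger sets `K` are irrelevant. -/
structure IsSASolution {S : Signature} (k : ℕ) (A : Struct S) [A.IsFinite] (X : Struct S)
    (x : (K : Finset X.Elem) → PartialHom X A K → ℚ) : Prop where
  mem_Icc : ∀ K : Finset X.Elem, K.card ≤ k → ∀ f, x K f ∈ Set.Icc (0 : ℚ) 1
  sum_eq_one : ∀ K : Finset X.Elem, K.card ≤ k → ∑ f, x K f = 1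
  marginal : ∀ (L K : Finset X.Elem) (hLK : L ⊆ K), K.card ≤ k → ∀ g : PartialHom X A L,
    ∑ f with PartialHom.restrict hLK f = g, x K f = x L g

/-- `SA^k(X)` has a feasible solution. -/
def SAFeasible {S : Signature} (k : ℕ) (A : Struct S) [A.IsFinite] (X : Struct S) : Prop :=
  ∃ x, IsSASolution k A X x

/-- The `k`-th level of the Sherali–Adams relaxation solves `PCSP(A, A')`: it accepts all the finite
instances `X` with `X → A` and it rejects all those with `X ↛ A'`. -/
def SolvedBySA {S : Signature} (k : ℕ) (A : Struct S) [A.IsFinite] (A' : Struct S) : Prop :=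
  (∀ X : Struct.{0} S, X.IsFinite → MapsTo X A → SAFeasible k A X) ∧
  (∀ X : Struct.{0} S, X.IsFinite → ¬ MapsTo X A' → ¬ SAFeasible k A X)

/-- `PCSP(A, A')` is solved by some level `k ≥ 1` of the Sherali–Adams hierarchy. -/
def SolvedBySomeSALevel {S : Signature} (A : Struct S) [A.IsFinite] (A' : Struct S) : Prop :=
  ∃ k : ℕ, 1 ≤ k ∧ SolvedBySA k A A'

end PCSP

/-!
From an instance `X` of `PCSP(A, A')` build an instance `Y` of `PCSP(B, B')` by gluing the powers
`B^F(U)`, where `F(U)` is the set of partial homomorphisms from `U` to `A` and `U` ranges over the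
sets of at most `m` elements of `X`, along the restrictions `F(U) → F(V)`.

A homomorphism `Y → B'` is a family of polymorphisms `B^F(U) → B'` compatible with minors. The
minion homomorphism turns it into such a family `A^F(U) → A'`, and evaluating its members at the
projections `F(U) → A` gives a homomorphism `X → A'`, as soon as `m` bounds the arities.

A solution `x` of a high level for `X` gives, on each set of few elements of `X`, a probability
distribution on partial homomorphisms to `A`. A map `F(U) → B` sends such a random partial
homomorphism to a random element of `B`. Two maps that are glued together have almost surely the
same value, so this is well defined on `Y`; it satisfies the constraints of `Y` almost surely, hence
the distributions of the values on the sets of at most `k` elements of `Y` solve `SA^k(Y)`.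
-/

namespace PCSP

attribute [ext] Hom

attribute [instance] Signature.IsFinite.typ Signature.IsFinite.sym

theorem Signature.exists_len_le (S : Signature) [Finite S.Sym] :
    ∃ m, 1 ≤ m ∧ ∀ R, S.len R ≤ m := by
  obtain ⟨m, hm⟩ := (Set.finite_range S.len).bddAbove
  exact ⟨max 1 m, le_max_left 1 m, fun R => (hm ⟨R, rfl⟩).trans (le_max_right 1 m)⟩

theorem PartialHom.toFun_injective {S : Signature} {X A : Struct S} {K : Finset X.Elem} :
    Function.Injective (PartialHom.toFun : PartialHom X A K → _) :=
  fun _ _ => PartialHom.ext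

theorem sum_fiberwise_of_injective {ι κ γ M : Type*} [Fintype ι] [Fintype κ] [AddCommMonoid M]
    {w : ι → M} {φ : ι → γ} {e : κ → γ} (he : Function.Injective e)
    (hφ : ∀ i, w i ≠ 0 → φ i ∈ Set.range e) (P : γ → Prop) :
    ∑ j with P (e j), ∑ i with φ i = e j, w i = ∑ i with P (φ i), w i := by
  rw [Finset.sum_comm' (t' := {i | P (φ i)}) (s' := fun i => {j | φ i = e j}) (by grind)]
  refine Finset.sum_congr rfl fun i _ => ?_
  by_cases hi : w i = 0
  · simp only [hi, Finset.sum_const_zero]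
  · obtain ⟨j, hj⟩ := hφ i hi
    simp only [← hj, he.eq_iff, Finset.filter_eq, Finset.mem_univ, if_true, Finset.sum_singleton]

/-! ### Solutions of the Sherali–Adams relaxation -/

section Solutions

variable {S : Signature} {X A : Struct S}

/-- The partial homomorphism induced on `K` by a homomorphism. -/
def Hom.toPartialHom (φ : Hom X A) (K : Finset X.Elem) : PartialHom X A K where
  toFun v := φ.toFun v.1.1 v.1.2
  map_rel R a ha _ := φ.map_rel R a ha

/-- The probability of the event `P` when a partial homomorphism on `K` is drawn with the weights
`x K`. -/
noncomputable def prob [A.IsFinite] (x : (K : Finset X.Elem) → PartialHom X A K → ℚ)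
    (K : Finset X.Elem) (P : PartialHom X A K → Prop) : ℚ :=
  ∑ f with P f, x K f

variable [A.IsFinite] {k l : ℕ} {x : (K : Finset X.Elem) → PartialHom X A K → ℚ}

theorem IsSASolution.of_prob (hnonneg : ∀ K : Finset X.Elem, K.card ≤ k → ∀ f, 0 ≤ x K f)
    (htrue : ∀ K : Finset X.Elem, K.card ≤ k → prob x K (fun _ => True) = 1)
    (hmarginal : ∀ (L K : Finset X.Elem) (hLK : L ⊆ K), K.card ≤ k → ∀ g : PartialHom X A L,
      prob x K (fun f => f.restrict hLK = g) = x L g) :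
    IsSASolution k A X x := by
  have hsum (K : Finset X.Elem) (hK : K.card ≤ k) : ∑ f, x K f = 1 := by
    simpa only [prob, Finset.filter_true] using htrue K hK
  refine ⟨fun K hK f => ⟨hnonneg K hK f, ?_⟩, hsum, hmarginal⟩
  rw [← hsum K hK]
  exact Finset.single_le_sum (fun g _ => hnonneg K hK g) (Finset.mem_univ f)

theorem SAFeasible.of_mapsTo (k : ℕ) (h : MapsTo X A) : SAFeasible k A X := by
  obtain ⟨φ⟩ := h
  refine ⟨fun K f => if f = φ.toPartialHom K then 1 else 0,
    .of_prob (fun K _ f => ?_) (fun K _ => ?_) fun L K hLK _ g => ?_⟩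
  · split_ifs <;> norm_num
  · simp [prob]
  · have hres : (φ.toPartialHom K).restrict hLK = φ.toPartialHom L := rfl
    simp [prob, hres, eq_comm]

theorem IsSASolution.restrict_ne_zero (hx : IsSASolution l A X x) {L K : Finset X.Elem}
    (hLK : L ⊆ K) (hK : K.card ≤ l) {f : PartialHom X A K} (hf : x K f ≠ 0) :
    x L (f.restrict hLK) ≠ 0 := by
  rw [← hx.marginal L K hLK hK]
  intro hzero
  rw [Finset.sum_eq_zero_iff_of_nonneg fun f _ => (hx.mem_Icc K hK f).1] at hzero
  exact hf (hzero f (by simp))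

theorem IsSASolution.exists_extension (hx : IsSASolution l A X x) {L K : Finset X.Elem}
    (hLK : L ⊆ K) (hK : K.card ≤ l) {g : PartialHom X A L} (hg : x L g ≠ 0) :
    ∃ f : PartialHom X A K, f.restrict hLK = g ∧ x K f ≠ 0 := by
  rw [← hx.marginal L K hLK hK] at hg
  obtain ⟨f, hf, hf0⟩ := Finset.exists_ne_zero_of_sum_ne_zero hg
  exact ⟨f, (Finset.mem_filter.1 hf).2, hf0⟩

theorem IsSASolution.prob_restrict (hx : IsSASolution l A X x) {L K : Finset X.Elem}
    (hLK : L ⊆ K) (hK : K.card ≤ l) (P : PartialHom X A L → Prop) :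
    prob x K (fun f => P (f.restrict hLK)) = prob x L P := by
  simp only [prob, ← hx.marginal L K hLK hK]
  exact (sum_fiberwise_of_injective Function.injective_id (fun f _ => ⟨f.restrict hLK, rfl⟩) P).symm

end Solutions

/-! ### Pushing solutions forward -/

/-- A reading of each element `y` of `Y` as a function, with values in `B`, of a partial
homomorphism from a finite set `scope y` of elements of `X` to `A`: a gadget along which solutions
for `X` are transported to solutions for `Y`. No compatibility with the relations is required. -/
structure LocalAssignment {S T : Signature} (X A : Struct S) (Y B : Struct T) where
  scope : Y.Elem → Finset X.Elem
  eval : (y : Y.Elem) → PartialHom X A (scope y) → B.dom y.1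

namespace LocalAssignment

variable {S T : Signature} {X A : Struct S} {Y B : Struct T} (D : LocalAssignment X A Y B)

/-- The elements of `X` needed to evaluate all elements of `K`. -/
noncomputable def scopes (K : Finset Y.Elem) : Finset X.Elem :=
  K.biUnion D.scope

theorem scope_subset_scopes {K : Finset Y.Elem} {y : Y.Elem} (hy : y ∈ K) :
    D.scope y ⊆ D.scopes K :=
  Finset.subset_biUnion_of_mem D.scope hy

theorem scopes_mono {L K : Finset Y.Elem} (hLK : L ⊆ K) : D.scopes L ⊆ D.scopes K :=
  Finset.biUnion_subset_biUnion_of_subset_left _ hLK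

/-- The simultaneous evaluation of the elements of `K`. -/
noncomputable def evalOn (K : Finset Y.Elem) (f : PartialHom X A (D.scopes K)) (v : K) :
    B.dom v.1.1 :=
  D.eval v.1 (f.restrict (D.scope_subset_scopes v.2))

variable [A.IsFinite] {k l : ℕ} {x : (K : Finset X.Elem) → PartialHom X A K → ℚ}

/-- The distribution of `D.evalOn K f` for `f` drawn from `x`. -/
noncomputable def pushforward (x : (K : Finset X.Elem) → PartialHom X A K → ℚ)
    (K : Finset Y.Elem) (g : PartialHom Y B K) : ℚ :=
  prob x (D.scopes K) fun f => D.evalOn K f = g.toFun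

theorem prob_pushforward [B.IsFinite] {K : Finset Y.Elem}
    (hhom : ∀ f, x (D.scopes K) f ≠ 0 →
      D.evalOn K f ∈ Set.range (PartialHom.toFun : PartialHom Y B K → _))
    (P : ((v : K) → B.dom v.1.1) → Prop) :
    prob (D.pushforward x) K (fun g => P g.toFun) =
      prob x (D.scopes K) fun f => P (D.evalOn K f) :=
  sum_fiberwise_of_injective PartialHom.toFun_injective hhom P

theorem isSASolution_pushforward [B.IsFinite] (hx : IsSASolution l A X x)
    (hcard : ∀ K : Finset Y.Elem, K.card ≤ k → (D.scopes K).card ≤ l)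
    (hhom : ∀ K : Finset Y.Elem, K.card ≤ k → ∀ f, x (D.scopes K) f ≠ 0 →
      D.evalOn K f ∈ Set.range (PartialHom.toFun : PartialHom Y B K → _)) :
    IsSASolution k B Y (D.pushforward x) := by
  refine .of_prob (fun K hK g => ?_) (fun K hK => ?_) fun L K hLK hK g => ?_
  · exact Finset.sum_nonneg fun f _ => (hx.mem_Icc _ (hcard K hK) f).1
  · rw [D.prob_pushforward (hhom K hK) fun _ => True]
    simpa only [prob, Finset.filter_true] using hx.sum_eq_one _ (hcard K hK)
  · calc
      prob (D.pushforward x) K (fun g' => g'.restrict hLK = g)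
        = prob (D.pushforward x) K fun g' => (fun v : L => g'.toFun ⟨v.1, hLK v.2⟩) = g.toFun := by
          simp only [← PartialHom.toFun_injective.eq_iff, PartialHom.restrict]
      _ = prob x (D.scopes K) fun f => D.evalOn L (f.restrict (D.scopes_mono hLK)) = g.toFun :=
          D.prob_pushforward (hhom K hK) fun b => (fun v : L => b ⟨v.1, hLK v.2⟩) = g.toFun
      _ = D.pushforward x L g :=
          hx.prob_restrict (D.scopes_mono hLK) (hcard K hK) fun f => D.evalOn L f = g.toFun

end LocalAssignment

/-! ### Gluing powers -/

/-- An element of type `s` of one of the powers `B^F(U)`, where `F(U)` is the set of partial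
homomorphisms from `U` to `A` and `U = scope` has at most `m` elements. -/
structure LocalElem {S T : Signature} (m : ℕ) (X A : Struct S) (B : Struct T) (s : T.Typ) where
  scope : Finset X.Elem
  card_le : scope.card ≤ m
  eval : PartialHom X A scope → B.dom s

namespace LocalElem

variable {S T : Signature} {m : ℕ} {X A : Struct S} {B : Struct T} {s : T.Typ}

instance [Finite X.Elem] [A.IsFinite] [B.IsFinite] : Finite (LocalElem m X A B s) :=
  Finite.of_injective
    (fun p => (⟨p.scope, p.eval⟩ : Σ U : Finset X.Elem, PartialHom X A U → B.dom s))
    (by rintro ⟨⟩ ⟨⟩ h; cases h; rfl)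

/-- `p` is the image of `q` under the map `B^F(V) → B^F(U)` given by restriction, `V ⊆ U`. -/
def IsPullback (p q : LocalElem m X A B s) : Prop :=
  ∃ h : q.scope ⊆ p.scope, ∀ f, p.eval f = q.eval (f.restrict h)

/-- `p` and `q` have almost surely the same value under the solution `x` of level `l`. -/
def AlmostEq (l : ℕ) (x : (K : Finset X.Elem) → PartialHom X A K → ℚ)
    (p q : LocalElem m X A B s) : Prop :=
  ∀ (W : Finset X.Elem) (hp : p.scope ⊆ W) (hq : q.scope ⊆ W), W.card ≤ l →
    ∀ f, x W f ≠ 0 → p.eval (f.restrict hp) = q.eval (f.restrict hq)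

variable {l : ℕ} {x : (K : Finset X.Elem) → PartialHom X A K → ℚ}

theorem IsPullback.almostEq {p q : LocalElem m X A B s} (h : p.IsPullback q) : AlmostEq l x p q :=
  fun _ hp _ _ f _ => h.2 (f.restrict hp)

variable [A.IsFinite]

theorem almostEq_equivalence (hx : IsSASolution l A X x) (hl : 3 * m ≤ l) :
    Equivalence (AlmostEq l x : LocalElem m X A B s → LocalElem m X A B s → Prop) where
  refl _ _ _ _ _ _ _ := rfl
  symm h W hq hp hW f hf := (h W hp hq hW f hf).symm
  trans {p q r} hpq hqr W hp hr hW f hf := by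
    have hprW : p.scope ∪ r.scope ⊆ W := Finset.union_subset hp hr
    have hcard : ((p.scope ∪ r.scope) ∪ q.scope).card ≤ l := by
      have := Finset.card_union_le (p.scope ∪ r.scope) q.scope
      have := Finset.card_union_le p.scope r.scope
      linarith [p.card_le, q.card_le, r.card_le]
    -- Only an extension of `f` to the scope of `q` can be compared with `q`.
    obtain ⟨g, hg, hg0⟩ := hx.exists_extension (K := (p.scope ∪ r.scope) ∪ q.scope)
      Finset.subset_union_left hcard (hx.restrict_ne_zero hprW hW hf)
    calc
      p.eval (f.restrict hp) = p.eval ((f.restrict hprW).restrict Finset.subset_union_left) := rfl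
      _ = p.eval (g.restrict _) := by rw [← hg]; rfl
      _ = q.eval (g.restrict Finset.subset_union_right) := hpq _ (by grind) _ hcard g hg0
      _ = r.eval (g.restrict _) := hqr _ _ (by grind) hcard g hg0
      _ = r.eval ((f.restrict hprW).restrict Finset.subset_union_right) := by rw [← hg]; rfl
      _ = r.eval (f.restrict hr) := rfl

theorem almostEq_of_mk_eq_mk (hx : IsSASolution l A X x) (hl : 3 * m ≤ l)
    {p q : LocalElem m X A B s} (h : Quot.mk IsPullback p = Quot.mk IsPullback q) :
    AlmostEq l x p q :=
  (almostEq_equivalence hx hl).eqvGen_iff.1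
    ((Quot.eqvGen_exact h).mono fun _ _ h => h.almostEq)

end LocalElem

/-- The instance of signature `T` obtained from the powers `B^F(U)`, for all sets `U` of at most `m`
elements of `X`, by identifying every element with its images under restriction, where `F(U)` is the
set of partial homomorphisms from `U` to `A`. -/
def gluedPowers {S T : Signature} (m : ℕ) (X A : Struct S) (B : Struct T) : Struct T where
  dom s := Quot (LocalElem.IsPullback : LocalElem m X A B s → LocalElem m X A B s → Prop)
  rel r := {b | ∃ (U : Finset X.Elem) (hU : U.card ≤ m)
    (y : (i : Fin (T.len r)) → PartialHom X A U → B.dom (T.ar r i)),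
    (∀ f, (fun i => y i f) ∈ B.rel r) ∧ b = fun i => Quot.mk _ ⟨U, hU, y i⟩}

namespace gluedPowers

section Feasibility

variable {S T : Signature} {m : ℕ} {X A : Struct S} {B : Struct T}

instance [Finite S.Typ] [A.IsFinite] [X.IsFinite] [B.IsFinite] : (gluedPowers m X A B).IsFinite :=
  ⟨fun _ => inferInstanceAs (Finite (Quot _))⟩

/-- Evaluation of the elements of the glued powers through arbitrary representatives. -/
noncomputable def assignment (m : ℕ) (X A : Struct S) (B : Struct T) :
    LocalAssignment X A (gluedPowers m X A B) B where
  scope e := (Quot.out e.2).scope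
  eval e := (Quot.out e.2).eval

theorem card_scopes_assignment_le (K : Finset (gluedPowers m X A B).Elem) :
    ((assignment m X A B).scopes K).card ≤ K.card * m :=
  Finset.card_biUnion_le_card_mul _ _ _ fun e _ => (Quot.out e.2).card_le

variable [A.IsFinite] {k l : ℕ} {x : (K : Finset X.Elem) → PartialHom X A K → ℚ}

theorem evalOn_assignment_mem_range (hx : IsSASolution l A X x) (h3 : 3 * m ≤ l)
    (hk : (k + 1) * m ≤ l) {K : Finset (gluedPowers m X A B).Elem} (hK : K.card ≤ k)
    {f : PartialHom X A ((assignment m X A B).scopes K)} (hf : x _ f ≠ 0) :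
    (assignment m X A B).evalOn K f ∈
      Set.range (PartialHom.toFun : PartialHom (gluedPowers m X A B) B K → _) := by
  refine ⟨⟨(assignment m X A B).evalOn K f, ?_⟩, rfl⟩
  rintro r _ ⟨U, hU, y, hy, rfl⟩ hb
  have hcard : ((assignment m X A B).scopes K ∪ U).card ≤ l := by
    have := Finset.card_union_le ((assignment m X A B).scopes K) U
    have := card_scopes_assignment_le K
    have := Nat.mul_le_mul_right m hK
    linarith
  obtain ⟨g, rfl, hg⟩ := hx.exists_extension Finset.subset_union_left hcard hf
  have hval (i) : (assignment m X A B).evalOn K (g.restrict Finset.subset_union_left) ⟨_, hb i⟩ =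
      y i (g.restrict Finset.subset_union_right) :=
    LocalElem.almostEq_of_mk_eq_mk hx h3 (q := ⟨U, hU, y i⟩) (Quot.out_eq _) _
      (((assignment m X A B).scope_subset_scopes (hb i)).trans Finset.subset_union_left)
      Finset.subset_union_right hcard g hg
  simpa only [hval] using hy (g.restrict Finset.subset_union_right)

theorem saFeasible [B.IsFinite] (h3 : 3 * m ≤ l) (hk : (k + 1) * m ≤ l) (h : SAFeasible l A X) :
    SAFeasible k B (gluedPowers m X A B) := by
  obtain ⟨x, hx⟩ := h
  refine ⟨_, (assignment m X A B).isSASolution_pushforward hx (fun K hK => ?_)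
    fun K hK f hf => evalOn_assignment_mem_range hx h3 hk hK hf⟩
  calc
    _ ≤ K.card * m := card_scopes_assignment_le K
    _ ≤ (k + 1) * m := Nat.mul_le_mul_right m (hK.trans k.le_succ)
    _ ≤ l := hk

end Feasibility

section Polymorphisms

variable {S T : Signature} {m : ℕ} {X A : Struct.{0} S} {B : Struct.{0} T} {B' : Struct T}
  {U V : Finset X.Elem}

/-- The restriction to `B^F(U)` of a homomorphism from the glued powers to `B'`. -/
def toPol (φ : Hom (gluedPowers m X A B) B') (U : Finset X.Elem) (hU : U.card ≤ m) :
    Pol B B' (PartialHom X A U) where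
  toFun s y := φ.toFun s (Quot.mk _ ⟨U, hU, y⟩)
  map_rel r y hy := φ.map_rel r _ ⟨U, hU, y, hy, rfl⟩

theorem minor_toPol (φ : Hom (gluedPowers m X A B) B') (hU : U.card ≤ m) (hV : V.card ≤ m)
    (hVU : V ⊆ U) : (toPol φ U hU).minor (PartialHom.restrict hVU) = toPol φ V hV := by
  ext s y
  exact congrArg (φ.toFun s) (Quot.sound ⟨hVU, fun _ => rfl⟩)

end Polymorphisms

end gluedPowers

section CompatiblePolymorphisms

variable {S : Signature}

/-- The set of entries of a tuple. -/
noncomputable def Struct.entries {X : Struct S} {R : S.Sym}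
    (a : (i : Fin (S.len R)) → X.dom (S.ar R i)) : Finset X.Elem :=
  Finset.univ.image fun i => ⟨S.ar R i, a i⟩

theorem Struct.mem_entries {X : Struct S} {R : S.Sym}
    (a : (i : Fin (S.len R)) → X.dom (S.ar R i)) (i : Fin (S.len R)) :
    (⟨S.ar R i, a i⟩ : X.Elem) ∈ Struct.entries a :=
  Finset.mem_image_of_mem _ (Finset.mem_univ i)

theorem Struct.card_entries_le {X : Struct S} {R : S.Sym}
    (a : (i : Fin (S.len R)) → X.dom (S.ar R i)) : (Struct.entries a).card ≤ S.len R :=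
  Finset.card_image_le.trans_eq (Finset.card_fin _)

/-- The projection `f ↦ f v`, an element of the power `A^F(U)`, where `F(U)` is the set of partial
homomorphisms from `U` to `A`. -/
def PartialHom.evalAt {X A : Struct S} {U : Finset X.Elem} {v : X.Elem} (hv : v ∈ U)
    (f : PartialHom X A U) : A.dom v.1 :=
  f.toFun ⟨v, hv⟩

theorem MapsTo.of_compatible_pol {m : ℕ} {X A : Struct.{0} S} {A' : Struct S} (hm : 1 ≤ m)
    (hlen : ∀ R, S.len R ≤ m)
    (p : (U : Finset X.Elem) → U.card ≤ m → Pol A A' (PartialHom X A U))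
    (hp : ∀ (U V : Finset X.Elem) (hU : U.card ≤ m) (hV : V.card ≤ m) (hVU : V ⊆ U),
      (p U hU).minor (PartialHom.restrict hVU) = p V hV) : MapsTo X A' := by
  have hcard (v : X.Elem) : ({v} : Finset X.Elem).card ≤ m := by rwa [Finset.card_singleton]
  let val (v : X.Elem) : A'.dom v.1 :=
    (p {v} (hcard v)).toFun v.1 (PartialHom.evalAt (Finset.mem_singleton_self v))
  have val_eq {U : Finset X.Elem} (hU : U.card ≤ m) {v : X.Elem} (hv : v ∈ U) :
      val v = (p U hU).toFun v.1 (PartialHom.evalAt hv) := by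
    simp only [val, ← hp U {v} hU (hcard v) (Finset.singleton_subset_iff.2 hv)]
    rfl
  refine ⟨⟨fun t a => val ⟨t, a⟩, fun R a ha => ?_⟩⟩
  have hU : (Struct.entries a).card ≤ m := (Struct.card_entries_le a).trans (hlen R)
  simp only [val_eq hU (Struct.mem_entries a _)]
  exact (p _ hU).map_rel R (fun i => PartialHom.evalAt (Struct.mem_entries a i))
    fun f => f.map_rel R a ha (Struct.mem_entries a)

end CompatiblePolymorphisms

theorem gluedPowers.mapsTo_of_polMinionHom {S T : Signature} {m : ℕ} {X A : Struct.{0} S}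
    [A.IsFinite] {A' : Struct S} {B : Struct.{0} T} {B' : Struct T} (hm : 1 ≤ m)
    (hlen : ∀ R, S.len R ≤ m) (ξ : PolMinionHom B B' A A')
    (h : MapsTo (gluedPowers m X A B) B') : MapsTo X A' := by
  obtain ⟨φ⟩ := h
  refine .of_compatible_pol hm hlen (fun U hU => ξ.map _ (toPol φ U hU)) fun U V hU hV hVU => ?_
  rw [← ξ.map_minor, minor_toPol]

end PCSP

/-- The factor `3` in the level makes almost sure equality transitive; `k + 1` leaves room for `k`
elements of the glued powers together with a constraint between them. -/
theorem corollary4p3_general {S T : PCSP.Signature} [Finite S.Typ] {A : PCSP.Struct.{0} S}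
    {A' : PCSP.Struct.{u} S} [A.IsFinite] {B : PCSP.Struct.{0} T} {B' : PCSP.Struct.{v} T}
    [B.IsFinite] {k m : ℕ} (hm : 1 ≤ m) (hlen : ∀ R, S.len R ≤ m)
    (hPol : Nonempty (PCSP.PolMinionHom B B' A A')) (hSA : PCSP.SolvedBySA k B B') :
    PCSP.SolvedBySA (max 3 (k + 1) * m) A A' := by
  obtain ⟨ξ⟩ := hPol
  refine ⟨fun X _ hXA => .of_mapsTo _ hXA, fun X _ hXA' hfeas => ?_⟩
  have hrejected : ¬ PCSP.MapsTo (PCSP.gluedPowers m X A B) B' :=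
    fun h => hXA' (PCSP.gluedPowers.mapsTo_of_polMinionHom hm hlen ξ h)
  refine hSA.2 _ inferInstance hrejected (PCSP.gluedPowers.saFeasible ?_ ?_ hfeas)
  · exact Nat.mul_le_mul_right m (le_max_left 3 (k + 1))
  · exact Nat.mul_le_mul_right m (le_max_right 3 (k + 1))

theorem corollary4p3 {S T : PCSP.Signature} [S.IsFinite] [T.IsFinite]
    (A : PCSP.Struct.{0} S) (A' : PCSP.Struct.{u} S) [A.IsFinite]
    (B : PCSP.Struct.{0} T) (B' : PCSP.Struct.{v} T) [B.IsFinite]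
    (hA : PCSP.MapsTo A A') (hB : PCSP.MapsTo B B')
    (hPol : Nonempty (PCSP.PolMinionHom B B' A A'))
    (hSA : PCSP.SolvedBySomeSALevel B B') :
    PCSP.SolvedBySomeSALevel A A' := by
  obtain ⟨m, hm, hlen⟩ := S.exists_len_le
  obtain ⟨k, -, hk⟩ := hSA
  exact ⟨_, Nat.mul_pos (by simp) hm, corollary4p3_general hm hlen hPol hk⟩
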